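/- Let $E$ be a real Banach space and $F$ a real Hilbert space with a Schauder basis $(b_i)_{i\in\mathbb N}$ and coefficient functionals $(b_i^*)$. Assume that $(b_i)$ is Besselian ($\sum_i\alpha_i b_i$ converges $\Rightarrow\sum_i\alpha_i^2<\infty$) and Hilbertian ($\sum_i\alpha_i^2<\infty\Rightarrow\sum_i\alpha_ib_i$ converges). Let $I_0,I_1\subset\mathbb N$ be disjoint (for instance with $I_0\cup I_1=\mathbb N$), let $G:E\to F$ be of class $C^1$, put $g_i:=b_i^*\circ G$, and assume $G(x)=\sum_{i\in I_0\cup I_1}g_i(x)b_i$ for all $x\in E$. Series over a subset of $\mathbb N$ are always summed in increasing order of the indices. Let $$\mathcal F=\{x\in E\mid g_i(x)=0,\ i\in I_0,\ g_i(x)\le 0,\ i\in I_1\},$$ $$K=\Big\{y\in F\ \Big|\ y=\sum_{i\in I_0\cup I_1}b_i^*(y)b_i,\ b_i^*(y)=0,\ i\in I_0,\ b_i^*(y)\le 0,\ i\in I_1\Big\}.$$ For $Q$ a subset of a normed space and $x\in Q$ let $\mathcal T_Q(x)$ be the Bouligand tangent cone, that is, the set of all $d$ such that $(x_k-x)/t_k\to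 d$ for some $x_k\in Q$, $x_k\to x$, $t_k>0$, $t_k\to0$. Let $x_0\in\mathcal F$, and put $$\Gamma_{\mathcal F}(x_0)=\{d\in E\mid DG(x_0)d\in\mathcal T_K(G(x_0))\},$$ $$I(x_0)=\{i\in I_1\mid g_i(x_0)=0\},\qquad I(x_0,d)=\{i\in I(x_0)\mid Dg_i(x_0)d=0\}.$$ For $J\subset\mathbb N$ let $X_J(x)$ be the closed linear span of $\{Dg_i(x)\mid i\in J\}$ in $E^*$, and let $Y(J)$ be the space of all $(c_i)_{i\in J}$ for which $\sum_{i\in J}c_ib_i$ converges, with the norm $\|c\|_{Y(J)}=\sup_N\|\sum_{i\in J,\,i\le N}c_ib_i\|$. Assume: (i) (RCRCQ+) There is a neighbourhood $V$ of $x_0$ such that for every $J$ with $I_0\subset J\subset I_0\cup I(x_0)$ there is $J_2\subset J$ such that 1. for every $x\in V$, $(Dg_i(x))_{i\in J_2}$ is a Schauder basis of $X_J(x)$; 2. for every $x\in V$ there is a linear topological isomorphism $z_x:X_J(x)\to X_J(x_0)$ with $z_x(Dg_i(x))=Dg_i(x_0)$ for all $i\in J_2$; 3. $\{(Dg_i(x_0)e)_{i\in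 J_2}\mid e\in E\}$ is closed in $Y(J_2)$; 4. the basis $(Dg_i(x_0))_{i\in J_2}$ of $X_J(x_0)$ is shrinking (the closed linear span of its coefficient functionals is $X_J(x_0)^*$) and boundedly complete (a series $\sum_{i\in J_2}\alpha_iDg_i(x_0)$ with bounded partial sums converges); 5. this basis is Besselian; 6. for every $i\in J_2$ the $i$-th coefficient functional of this basis, an element of $X_J(x_0)^*$, is the evaluation $\varphi\mapsto\varphi(e_i)$ at some $e_i\in E$. (ii) (H1) For every $d\in\Gamma_{\mathcal F}(x_0)$ and every $r:(0,1)\to E$ with $\|r(t)\|/t\to0$ as $t\downarrow0$ there is $\varepsilon_0\in(0,1)$ such that $g_i(x_0+td+r(t))\le0$ for all $i\in I_1\setminus I(x_0,d)$ and all $t\in(0,\varepsilon_0)$. Then the Abadie condition $\Gamma_{\mathcal F}(x_0)=\mathcal T_{\mathcal F}(x_0)$ holds. Moreover, for each $d\in\mathcal T_{\mathcal F}(x_0)$ there is $r:(0,1)\to E$ with $\|r(t)\|/t\to0$ as $t\downarrow0$ such that, with $J(d):=I_0\cup I(x_0,d)$, for all sufficiently small $t>0$, $$g_i(x_0+td+r(t))=0\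 \ (i\in J(d)),\qquad g_\ell(x_0+td+r(t))\le0\ \ (\ell\in I_1\setminus J(d)).$$ -/

import Mathlib

open Filter Topology
open scoped ENNReal

namespace AbadieRCRCQ

noncomputable section

/-! ### Series and Schauder bases indexed by a (finite or infinite) set of natural numbers -/

open Classical in
/-- The elements of `J` that are smaller than `n`. -/
def initialSegment (J : Set ℕ) (n : ℕ) : Finset J :=
  (Finset.range n).subtype (fun i => i ∈ J)

/-- Summation over `J ⊆ ℕ` in increasing order of the indices: limits of the partial sums over
the initial segments of `J`. For finite `J` this is the ordinary finite sum. -/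
def orderedSum (J : Set ℕ) : SummationFilter J where
  filter := atTop.map (initialSegment J)

section Bases

variable {β : Type*} {X : Type*} [NormedAddCommGroup X] [NormedSpace ℝ X]
  {L : SummationFilter β}

/-- Convergence of `∑ αᵢ cᵢ` implies `∑ αᵢ² < ∞`. -/
def IsBesselian (c : GeneralSchauderBasis β ℝ X L) : Prop :=
  ∀ α : β → ℝ, Summable (fun i => α i • c i) L → Summable (fun i => α i ^ 2)

/-- `∑ αᵢ² < ∞` implies convergence of `∑ αᵢ cᵢ`. -/
def IsHilbertian (c : GeneralSchauderBasis β ℝ X L) : Prop :=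
  ∀ α : β → ℝ, Summable (fun i => α i ^ 2) → Summable (fun i => α i • c i) L

/-- The biorthogonal functionals have dense linear span in the dual space. -/
def IsShrinking (c : GeneralSchauderBasis β ℝ X L) : Prop :=
  (Submodule.span ℝ (Set.range c.coord)).topologicalClosure = ⊤

/-- A series with bounded partial sums converges. -/
def IsBoundedlyComplete {J : Set ℕ} (c : GeneralSchauderBasis J ℝ X (orderedSum J)) : Prop :=
  ∀ α : J → ℝ, (∃ C : ℝ, ∀ n, ‖∑ i ∈ initialSegment J n, α i • c i‖ ≤ C) →
    Summable (fun i => α i • c i) (orderedSum J)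

/-- The closed linear span of the vectors `v i`, `i ∈ J`. -/
def closedSpan (v : ℕ → X) (J : Set ℕ) : Submodule ℝ X :=
  (Submodule.span ℝ (v '' J)).topologicalClosure

/-- The sequence space `Y(J)` of all `(cᵢ)_{i ∈ J}` such that `∑_{i ∈ J} cᵢ vᵢ` converges. -/
def seqSpace (v : ℕ → X) (J : Set ℕ) : Set (J → ℝ) :=
  {c | Summable (fun i : J => c i • v i) (orderedSum J)}

/-- The norm of `Y(J)`: the supremum of the norms of the partial sums of `∑_{i ∈ J} cᵢ vᵢ`
(with values in `[0, ∞]`, finite on `Y(J)`). -/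
def seqNorm (v : ℕ → X) (J : Set ℕ) (c : J → ℝ) : ℝ≥0∞ :=
  ⨆ n : ℕ, ‖∑ i ∈ initialSegment J n, c i • v i‖ₑ

/-- The set `S` of sequences is closed in `Y(J)` for the norm of `Y(J)`. -/
def IsClosedInSeqSpace (v : ℕ → X) (J : Set ℕ) (S : Set (J → ℝ)) : Prop :=
  ∀ c ∈ seqSpace v J,
    (∀ ε : ℝ≥0∞, 0 < ε → ∃ s ∈ S ∩ seqSpace v J, seqNorm v J (s - c) < ε) → c ∈ S

end Bases

section Cones

variable {X : Type*} [NormedAddCommGroup X] [NormedSpace ℝ X]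

/-- The Bouligand tangent cone to `Q` at `x`. -/
def tangentCone (Q : Set X) (x : X) : Set X :=
  {d | ∃ (u : ℕ → X) (t : ℕ → ℝ), (∀ k, u k ∈ Q) ∧ (∀ k, 0 < t k) ∧
    Tendsto u atTop (𝓝 x) ∧ Tendsto t atTop (𝓝 0) ∧
    Tendsto (fun k => (t k)⁻¹ • (u k - x)) atTop (𝓝 d)}

end Cones

section Problem

variable {E F : Type*} [NormedAddCommGroup E] [NormedSpace ℝ E]
  [NormedAddCommGroup F] [NormedSpace ℝ F]

/-- The constraint functions `gᵢ(x) = bᵢ*(G(x))`. -/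
def constraint (b : SchauderBasis ℝ F) (G : E → F) (i : ℕ) (x : E) : ℝ :=
  b.coord i (G x)

/-- The derivatives `Dgᵢ(x)` of the constraint functions, as elements of the dual of `E`. -/
def dconstraint (b : SchauderBasis ℝ F) (G : E → F) (x : E) (i : ℕ) : StrongDual ℝ E :=
  fderiv ℝ (constraint b G i) x

/-- The basis cone: the vectors `y = ∑_{i ∈ I₀ ∪ I₁} bᵢ*(y) bᵢ` with `bᵢ*(y) = 0` on `I₀` and
`bᵢ*(y) ≤ 0` on `I₁`. -/
def basisCone (b : SchauderBasis ℝ F) (I₀ I₁ : Set ℕ) : Set F :=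
  {y | HasSum (fun i : ↥(I₀ ∪ I₁) => b.coord i y • b i) y (orderedSum (I₀ ∪ I₁)) ∧
    (∀ i ∈ I₀, b.coord i y = 0) ∧ ∀ i ∈ I₁, b.coord i y ≤ 0}

/-- The constraint set `𝓕`. -/
def feasibleSet (b : SchauderBasis ℝ F) (G : E → F) (I₀ I₁ : Set ℕ) : Set E :=
  {x | (∀ i ∈ I₀, constraint b G i x = 0) ∧ ∀ i ∈ I₁, constraint b G i x ≤ 0}

/-- The linearized cone `Γ` to the constraint set. -/
def linearizedCone (b : SchauderBasis ℝ F) (G : E → F) (I₀ I₁ : Set ℕ) (x : E) : Set E :=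
  {d | fderiv ℝ G x d ∈ tangentCone (basisCone b I₀ I₁) (G x)}

/-- The active inequality indices `I(x)`. -/
def activeSet (b : SchauderBasis ℝ F) (G : E → F) (I₁ : Set ℕ) (x : E) : Set ℕ :=
  {i | i ∈ I₁ ∧ constraint b G i x = 0}

/-- The index set `I(x, d)`. -/
def activeSetDir (b : SchauderBasis ℝ F) (G : E → F) (I₁ : Set ℕ) (x d : E) : Set ℕ :=
  {i | i ∈ activeSet b G I₁ x ∧ dconstraint b G x i d = 0}

/-- A continuous linear functional on a space `W` of functionals on `E` is the evaluation at
some element of `E`. -/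
def IsRepresentedIn {W : Submodule ℝ (StrongDual ℝ E)} (ψ : StrongDual ℝ W) : Prop :=
  ∃ e : E, ∀ φ : W, ψ φ = (φ : StrongDual ℝ E) e

/-- The Constant Rank Condition Plus for `(gᵢ)_{i ∈ J}` at `x₀` with the neighbourhood `V`.
A family forms a Schauder basis of a space when it is the family of vectors of a Schauder basis
of this space, the series being summed in increasing order of the indices. -/
def CRCPlus (b : SchauderBasis ℝ F) (G : E → F) (J : Set ℕ) (x₀ : E) (V : Set E) : Prop :=
  ∃ J₂ : Set ℕ, J₂ ⊆ J ∧
    (∀ x ∈ V, ∃ c : GeneralSchauderBasis J₂ ℝ (closedSpan (dconstraint b G x) J)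
        (orderedSum J₂), ∀ i : J₂, (c i : StrongDual ℝ E) = dconstraint b G x i) ∧
    (∀ x ∈ V, ∃ z : closedSpan (dconstraint b G x) J ≃L[ℝ] closedSpan (dconstraint b G x₀) J,
      ∀ φ : closedSpan (dconstraint b G x) J, ∀ i ∈ J₂,
        (φ : StrongDual ℝ E) = dconstraint b G x i →
          (z φ : StrongDual ℝ E) = dconstraint b G x₀ i) ∧
    IsClosedInSeqSpace b J₂
      (Set.range fun (e : E) (i : J₂) => dconstraint b G x₀ i e) ∧
    ∃ c : GeneralSchauderBasis J₂ ℝ (closedSpan (dconstraint b G x₀) J) (orderedSum J₂),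
      (∀ i : J₂, (c i : StrongDual ℝ E) = dconstraint b G x₀ i) ∧
      IsShrinking c ∧ IsBoundedlyComplete c ∧ IsBesselian c ∧
      ∀ i : J₂, IsRepresentedIn (c.coord i)

/-- The Relaxed Constant Rank Constraint Qualification Plus at `x₀`. -/
def RCRCQPlus (b : SchauderBasis ℝ F) (G : E → F) (I₀ I₁ : Set ℕ) (x₀ : E) : Prop :=
  ∃ V ∈ 𝓝 x₀, ∀ J : Set ℕ, I₀ ⊆ J → J ⊆ I₀ ∪ activeSet b G I₁ x₀ → CRCPlus b G J x₀ V

/-- `‖r(t)‖ / t → 0` as `t ↓ 0`. -/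
def IsSmallCurve (r : ℝ → E) : Prop :=
  Tendsto (fun t : ℝ => ‖r t‖ / t) (𝓝[>] 0) (𝓝 0)

/-- Condition (H1). Only the values of `r` at small positive arguments matter, so `r` may be
taken to be defined on all of `ℝ`. -/
def ConditionH1 (b : SchauderBasis ℝ F) (G : E → F) (I₀ I₁ : Set ℕ) (x₀ : E) : Prop :=
  ∀ d ∈ linearizedCone b G I₀ I₁ x₀, ∀ r : ℝ → E, IsSmallCurve r →
    ∃ ε > 0, ∀ i ∈ I₁ \ activeSetDir b G I₁ x₀ d, ∀ t ∈ Set.Ioo (0 : ℝ) ε,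
      constraint b G i (x₀ + t • d + r t) ≤ 0

end Problem

end

end AbadieRCRCQ

namespace AbadieRCRCQ

/-! `tangentCone` ⊆ `linearizedCone` is the chain rule. For the converse, fix `d` in the linearized
cone and put `J = I₀ ∪ I(x₀, d)`, so that `d` annihilates every `Dgᵢ(x₀)`, `i ∈ J`. It suffices to
find a curve tangent to `d` on which all `gᵢ`, `i ∈ J`, vanish: (H1) handles the other inequalities.
Such a curve comes from `H = T ∘ G`, where `T` sends `y` to its coefficients on `J₂`, in `ℓ²`
because the basis is Besselian. The derivative of `H` at `x₀` is onto `ℓ²`: its range contains the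
unit vectors, by the representing elements `eᵢ`, and it is closed in `Y(J₂)`, whose norm is
dominated by that of `ℓ²` because the basis is Hilbertian. Lyusternik's theorem then gives a curve
in `{H = 0}` tangent to `d`. It remains to see that the `gᵢ` with `i ∈ J \ J₂` vanish on this fibre
near `x₀`. At every `x` near `x₀`, `Dgᵢ(x)` lies in the closed span of the `Dgⱼ(x)`, `j ∈ J₂`, so
`gᵢ` varies to first order not at all along the fibre. No splitting of the kernel of `DH(x₀)` is
used to parametrize the fibre; instead, Caristi's principle chains small steps inside it from `x₀`
to any nearby point (`eq_of_infinitesimally_constant`). -/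

/-! ### Variational principle -/

/-- Ekeland's principle in the form of Caristi: below every point of a closed set there is a
minimal one for the order `dist p w ≤ φ p - φ w`. -/
theorem exists_caristi_minimal {X : Type*} [MetricSpace X] [CompleteSpace X] {S : Set X}
    (hS : IsClosed S) {φ : X → ℝ} (hφ : Continuous φ) (hφ0 : ∀ p, 0 ≤ φ p) {x : X} (hx : x ∈ S) :
    ∃ z ∈ S, dist x z ≤ φ x - φ z ∧ ∀ w ∈ S, dist z w ≤ φ z - φ w → w = z := by
  let T : X → Set X := fun p => {w | w ∈ S ∧ dist p w ≤ φ p - φ w}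
  have hself : ∀ p ∈ S, p ∈ T p := fun p hp => ⟨hp, by simp⟩
  have htrans : ∀ p q w, q ∈ T p → w ∈ T q → w ∈ T p := fun p q w hq hw =>
    ⟨hw.1, by linarith [dist_triangle p q w, hq.2, hw.2]⟩
  have hbdd : ∀ p, BddBelow (φ '' T p) := fun p => ⟨0, by rintro _ ⟨w, -, rfl⟩; exact hφ0 w⟩
  -- Each iterate nearly minimizes `φ` among the points below its predecessor, with error `2⁻ⁿ`.
  have hnext : ∀ (n : ℕ) (p : S), ∃ q : S, (q : X) ∈ T p ∧
      ∀ w ∈ T p, φ q ≤ φ w + (1 / 2 : ℝ) ^ n := by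
    intro n p
    obtain ⟨_, ⟨q, hq, rfl⟩, hlt⟩ := Real.lt_sInf_add_pos
      (Set.Nonempty.image φ ⟨_, hself p p.2⟩) (show (0 : ℝ) < (1 / 2) ^ n by positivity)
    exact ⟨⟨q, hq.1⟩, hq, fun w hw => by
      linarith [csInf_le (hbdd p) (Set.mem_image_of_mem φ hw)]⟩
  choose next hnext1 hnext2 using hnext
  let u : ℕ → S := fun n => Nat.rec ⟨x, hx⟩ (fun n p => next n p) n
  have hu : ∀ n, u (n + 1) = next n (u n) := fun n => rfl
  have hmem : ∀ n k, (u (n + k)).1 ∈ T (u n).1 := by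
    intro n k
    induction k with
    | zero => exact hself _ (u n).2
    | succ k ih => exact htrans _ _ _ ih (by rw [← add_assoc, hu]; exact hnext1 _ _)
  have hanti : Antitone fun n => φ (u n).1 := antitone_nat_of_succ_le fun n => by
    linarith [(hmem n 1).2, dist_nonneg (x := (u n).1) (y := (u (n + 1)).1)]
  have hlim := tendsto_atTop_ciInf hanti ⟨0, by rintro _ ⟨n, rfl⟩; exact hφ0 _⟩
  have hcauchy : CauchySeq fun n => (u n).1 := by
    refine Metric.cauchySeq_iff'.2 fun ε hε => ?_
    obtain ⟨n, hn⟩ := Metric.cauchySeq_iff'.1 hlim.cauchySeq ε hε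
    refine ⟨n, fun m hm => ?_⟩
    have h1 := hn m hm
    obtain ⟨k, rfl⟩ := Nat.exists_eq_add_of_le hm
    rw [Real.dist_eq, abs_sub_comm] at h1
    rw [dist_comm]
    exact ((hmem n k).2.trans (le_abs_self _)).trans_lt h1
  obtain ⟨z, hz⟩ := cauchySeq_tendsto_of_complete hcauchy
  have hzS : z ∈ S := hS.mem_of_tendsto hz (Eventually.of_forall fun n => (u n).2)
  have hzT : ∀ n, z ∈ T (u n).1 := fun n => ⟨hzS, by
    refine le_of_tendsto_of_tendsto (tendsto_const_nhds.dist hz)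
      (tendsto_const_nhds.sub ((hφ.tendsto z).comp hz)) ?_
    filter_upwards [eventually_ge_atTop n] with m hm
    obtain ⟨k, rfl⟩ := Nat.exists_eq_add_of_le hm
    exact (hmem n k).2⟩
  refine ⟨z, hzS, (hzT 0).2, fun w hw hzw => ?_⟩
  -- A point `w` below `z` is below every iterate, so near-minimality forces `φ z ≤ φ w`, and then
  -- `dist z w ≤ 0`.
  have hle : φ z ≤ φ w := by
    have h1 : Tendsto (fun n => φ w + (1 / 2 : ℝ) ^ n) atTop (𝓝 (φ w + 0)) :=
      tendsto_const_nhds.add (tendsto_pow_atTop_nhds_zero_of_lt_one (by norm_num) (by norm_num))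
    rw [add_zero] at h1
    refine ge_of_tendsto h1 (Eventually.of_forall fun n => ?_)
    have h2 := hnext2 n (u n) w (htrans _ _ _ (hzT n) ⟨hw, hzw⟩)
    rw [← hu] at h2
    linarith [(hzT (n + 1)).2, dist_nonneg (x := (u (n + 1)).1) (y := z)]
  exact (dist_le_zero.1 (by linarith)).symm

/-! ### Geometry of the fibre of a submersion without a split kernel -/

section Fibres

variable {E Y : Type*} [NormedAddCommGroup E] [NormedSpace ℝ E]
  [NormedAddCommGroup Y] [NormedSpace ℝ Y]

/-- Metric regularity of `{H = 0}` near a point where the strict derivative is onto. -/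
theorem exists_approximatesLinearOn_and_correction [CompleteSpace E] [CompleteSpace Y]
    {H : E → Y} {A : E →L[ℝ] Y} {x₀ : E} (hH : HasStrictFDerivAt H A x₀)
    (hA : Function.Surjective A) {V : Set E} (hV : V ∈ 𝓝 x₀) :
    ∃ (K R : ℝ) (c : NNReal), 0 < K ∧ 0 < R ∧ 8 * c * K ≤ 1 ∧
      Metric.closedBall x₀ R ⊆ V ∧ ApproximatesLinearOn H A (Metric.closedBall x₀ R) c ∧
      ∀ p, Metric.closedBall p (K * ‖H p‖) ⊆ Metric.closedBall x₀ R →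
        ∃ q, ‖q - p‖ ≤ K * ‖H p‖ ∧ H q = 0 := by
  let N := A.nonlinearRightInverseOfSurjective (LinearMap.range_eq_top.2 hA)
  have hN : 0 < N.nnnorm :=
    A.nonlinearRightInverseOfSurjective_nnnorm_pos (LinearMap.range_eq_top.2 hA)
  -- With `c = 1 / (16 N)` and `K = 2 N` one gets `8 c K = 1`, and the image of the ball of radius
  -- `K ‖H p‖` contains the ball of radius `15/8 ‖H p‖` about `H p`, hence `0`.
  obtain ⟨s, hs, hsapprox⟩ := hH.approximates_deriv_on_nhds (c := N.nnnorm⁻¹ / 16)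
    (Or.inr (by positivity))
  obtain ⟨R, hR, hRs⟩ := Metric.nhds_basis_closedBall.mem_iff.1 (inter_mem hs hV)
  have hN' : (0 : ℝ) < N.nnnorm := hN
  refine ⟨2 * N.nnnorm, R, N.nnnorm⁻¹ / 16, by positivity, hR, ?_, fun x hx => (hRs hx).2,
    hsapprox.mono_set fun x hx => (hRs hx).1, fun p hp => ?_⟩
  · push_cast
    field_simp
    norm_num
  · have hsurj := hsapprox.surjOn_closedBall_of_nonlinearRightInverse N
      (ε := 2 * N.nnnorm * ‖H p‖) (b := p) (by positivity) fun x hx => (hRs (hp hx)).1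
    obtain ⟨q, hq, hq0⟩ := hsurj (show (0 : Y) ∈ _ by
      rw [mem_closedBall_iff_norm, zero_sub, norm_neg]
      push_cast
      have : ((N.nnnorm : ℝ)⁻¹ - (N.nnnorm : ℝ)⁻¹ / 16) * (2 * N.nnnorm * ‖H p‖)
          = 15 / 8 * ‖H p‖ := by field_simp; ring
      rw [this]
      linarith [norm_nonneg (H p)])
    exact ⟨q, mem_closedBall_iff_norm.1 hq, hq0⟩

/-- One can move inside the fibre `{H = 0}` from `x` towards `y`, by a small step of
controlled length. -/
theorem exists_fibre_step {H : E → Y} {A : E →L[ℝ] Y} {s : Set E} {K : ℝ} {c : NNReal}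
    (hK : 0 < K) (hcK : 8 * c * K ≤ 1) (happrox : ApproximatesLinearOn H A s c)
    (hcorr : ∀ p, Metric.closedBall p (K * ‖H p‖) ⊆ s → ∃ q, ‖q - p‖ ≤ K * ‖H p‖ ∧ H q = 0)
    {x y : E} (hx : H x = 0) (hy : H y = 0) (hs : Metric.closedBall x (2 * ‖y - x‖) ⊆ s)
    {τ : ℝ} (hτ0 : 0 ≤ τ) (hτ1 : τ ≤ 1) :
    ∃ q, H q = 0 ∧ ‖q - x‖ ≤ 2 * τ * ‖y - x‖ ∧ ‖q - y‖ ≤ (1 - τ / 2) * ‖y - x‖ := by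
  set p := x + τ • (y - x) with hp
  have hpx : ‖p - x‖ = τ * ‖y - x‖ := by
    rw [hp, add_sub_cancel_left, norm_smul, Real.norm_of_nonneg hτ0]
  have hpy : ‖p - y‖ = (1 - τ) * ‖y - x‖ := by
    rw [show p - y = (1 - τ) • (x - y) by rw [hp]; module, norm_smul,
      Real.norm_of_nonneg (by linarith), norm_sub_rev]
  have hn := norm_nonneg (y - x)
  have hxs : x ∈ s := hs (Metric.mem_closedBall_self (by positivity))
  have hys : y ∈ s := hs (by rw [mem_closedBall_iff_norm]; linarith)
  have hps : p ∈ s := hs (by rw [mem_closedBall_iff_norm, hpx]; nlinarith)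
  -- Since `H` vanishes at both ends, `A` is small on the chord. The correction of `p` therefore
  -- costs at most a quarter of the progress `τ ‖y - x‖`.
  have h1 : ‖A (y - x)‖ ≤ c * ‖y - x‖ := by
    simpa only [hx, hy, sub_self, zero_sub, norm_neg] using happrox y hys x hxs
  have h2 : ‖H p - τ • A (y - x)‖ ≤ c * (τ * ‖y - x‖) := by
    have := happrox p hps x hxs
    rwa [hpx, hx, sub_zero, hp, add_sub_cancel_left, map_smul, ← hp] at this
  have h3 : ‖H p‖ ≤ 2 * c * (τ * ‖y - x‖) := by
    have := norm_add_le (H p - τ • A (y - x)) (τ • A (y - x))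
    rw [sub_add_cancel, norm_smul, Real.norm_of_nonneg hτ0] at this
    nlinarith
  have h4 : K * ‖H p‖ ≤ τ / 4 * ‖y - x‖ := by
    have hm : 0 ≤ τ * ‖y - x‖ := by positivity
    nlinarith
  obtain ⟨q, hqp, hq⟩ := hcorr p fun w hw => hs (by
    rw [mem_closedBall_iff_norm] at hw ⊢
    have := norm_add_le (w - p) (p - x)
    rw [sub_add_sub_cancel] at this
    nlinarith)
  refine ⟨q, hq, ?_, ?_⟩
  · have := norm_add_le (q - p) (p - x)
    rw [sub_add_sub_cancel] at this
    nlinarith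
  · have := norm_add_le (q - p) (p - y)
    rw [sub_add_sub_cancel] at this
    nlinarith

/-- A function that is infinitesimally constant along the fibre `{H = 0}` near `x₀` is constant
along this fibre near `x₀`. -/
theorem eq_of_infinitesimally_constant [CompleteSpace E] {H : E → Y} {A : E →L[ℝ] Y} {x₀ : E}
    {K R : ℝ} {c : NNReal} (hK : 0 < K) (hcK : 8 * c * K ≤ 1)
    (happrox : ApproximatesLinearOn H A (Metric.closedBall x₀ R) c)
    (hcorr : ∀ p, Metric.closedBall p (K * ‖H p‖) ⊆ Metric.closedBall x₀ R →
      ∃ q, ‖q - p‖ ≤ K * ‖H p‖ ∧ H q = 0)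
    (hHc : Continuous H) {g : E → ℝ} (hg : Continuous g)
    (hloc : ∀ x ∈ Metric.closedBall x₀ R, ∀ κ > 0, ∀ᶠ q in 𝓝 x, H x = 0 → H q = 0 →
      |g q - g x| ≤ κ * ‖q - x‖)
    {y : E} (hx₀ : H x₀ = 0) (hy : H y = 0) (hyR : 8 * ‖y - x₀‖ ≤ R) : g y = g x₀ := by
  have key : ∀ κ > 0, |g y - g x₀| ≤ κ * (4 * ‖y - x₀‖) := by
    intro κ hκ
    -- Caristi's principle is applied to the graph of `κ⁻¹ g` over the fibre with the sup metric, so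
    -- that one inequality controls both the displacement and the variation of `g`.
    let S : Set (E × ℝ) :=
      {p | p.1 ∈ Metric.closedBall x₀ R ∧ H p.1 = 0 ∧ p.2 = κ⁻¹ * g p.1}
    have hS : IsClosed S := by
      refine (Metric.isClosed_closedBall.preimage continuous_fst).inter
        ((isClosed_eq (hHc.comp continuous_fst) continuous_const).inter
          (isClosed_eq continuous_snd (continuous_const.mul (hg.comp continuous_fst))))
    have hn := norm_nonneg (y - x₀)
    -- The factor `4` is the ratio of the step length `2τ ‖y - z‖` to the guaranteed gain `τ/2 ‖y -
    -- z‖`. Every `z ≠ y` then admits a strictly lower point, so the minimal point lies over `y`.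
    obtain ⟨⟨z, a⟩, ⟨hzR, hz, ha⟩, hzx, hmin⟩ := exists_caristi_minimal hS
      (φ := fun p => 4 * ‖y - p.1‖) (by fun_prop) (fun p => by positivity)
      (x := (x₀, κ⁻¹ * g x₀)) ⟨Metric.mem_closedBall_self (by linarith), hx₀, rfl⟩
    obtain rfl : a = κ⁻¹ * g z := ha
    rw [Prod.dist_eq, max_le_iff] at hzx
    obtain ⟨hzx1, hzx2⟩ := hzx
    simp only at hzx1 hzx2 hzR hz
    have hzy : z = y := by
      by_contra hne
      have hpos : 0 < ‖y - z‖ := norm_pos_iff.2 (sub_ne_zero.2 (Ne.symm hne))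
      have hzx' : ‖z - x₀‖ ≤ 4 * ‖y - x₀‖ := by
        rw [← dist_eq_norm, dist_comm]; linarith
      obtain ⟨δ, hδ, hball⟩ := Metric.eventually_nhds_iff.1 (hloc z hzR κ hκ)
      set τ := min 1 (δ / (4 * ‖y - z‖)) with hτ
      have hτ0 : 0 < τ := by positivity
      have hτδ : τ * (4 * ‖y - z‖) ≤ δ := by
        rw [← le_div_iff₀ (by positivity)]; exact min_le_right _ _
      have hyz : ‖y - z‖ ≤ ‖y - x₀‖ := by
        linarith [dist_nonneg (x := x₀) (y := z)]
      obtain ⟨q, hq, hqz, hqy⟩ := exists_fibre_step hK hcK happrox hcorr hz hy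
        (fun w hw => by
          rw [mem_closedBall_iff_norm] at hw ⊢
          have := norm_add_le (w - z) (z - x₀)
          rw [sub_add_sub_cancel] at this
          linarith) hτ0.le (min_le_left _ _)
      have hqR : q ∈ Metric.closedBall x₀ R := by
        rw [mem_closedBall_iff_norm]
        have := norm_add_le (q - z) (z - x₀)
        rw [sub_add_sub_cancel] at this
        nlinarith [min_le_left 1 (δ / (4 * ‖y - z‖))]
      have hgq : |g q - g z| ≤ κ * ‖q - z‖ :=
        hball (by rw [dist_eq_norm]; nlinarith) hz hq
      rw [norm_sub_rev q y] at hqy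
      have hqeq := hmin (q, κ⁻¹ * g q) ⟨hqR, hq, rfl⟩ (by
        rw [Prod.dist_eq, max_le_iff]
        simp only
        constructor
        · rw [dist_comm, dist_eq_norm]; linarith
        · rw [Real.dist_eq, ← mul_sub, abs_mul, abs_of_pos (inv_pos.2 hκ), abs_sub_comm]
          have : κ⁻¹ * |g q - g z| ≤ κ⁻¹ * (κ * ‖q - z‖) := by gcongr
          rw [inv_mul_cancel_left₀ hκ.ne'] at this
          linarith)
      have : q = z := congrArg Prod.fst hqeq
      rw [this] at hqy
      nlinarith
    subst hzy
    rw [Real.dist_eq, ← mul_sub, abs_mul, abs_of_pos (inv_pos.2 hκ), abs_sub_comm,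
      inv_mul_le_iff₀ hκ] at hzx2
    simpa using hzx2
  have h0 : |g y - g x₀| ≤ 0 := by
    have ht : Tendsto (fun κ : ℝ => κ * (4 * ‖y - x₀‖)) (𝓝[>] 0) (𝓝 (0 * (4 * ‖y - x₀‖))) :=
      (tendsto_id.mono_left nhdsWithin_le_nhds).mul_const _
    rw [zero_mul] at ht
    exact ge_of_tendsto ht (by filter_upwards [self_mem_nhdsWithin] with κ hκ using key κ hκ)
  exact sub_eq_zero.1 (abs_nonpos_iff.1 h0)

/-- A direction in the kernel of the derivative is tangent to the fibre `{H = 0}`. -/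
theorem exists_isSmallCurve_fibre {H : E → Y} {A : E →L[ℝ] Y} {x₀ d : E} {K R : ℝ}
    (hR : 0 < R) (hH : HasFDerivAt H A x₀)
    (hcorr : ∀ p, Metric.closedBall p (K * ‖H p‖) ⊆ Metric.closedBall x₀ R →
      ∃ q, ‖q - p‖ ≤ K * ‖H p‖ ∧ H q = 0)
    (hx₀ : H x₀ = 0) (hd : A d = 0) :
    ∃ r : ℝ → E, IsSmallCurve r ∧ ∀ᶠ t in 𝓝[>] (0 : ℝ), H (x₀ + t • d + r t) = 0 := by
  have hline : Tendsto (fun t : ℝ => x₀ + t • d) (𝓝[>] 0) (𝓝 x₀) := by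
    have : Continuous fun t : ℝ => x₀ + t • d := by fun_prop
    simpa using (this.tendsto 0).mono_left nhdsWithin_le_nhds
  -- As `A d = 0`, the defect on the line is `o(t)`, and so is the correction bounded by `K` times
  -- it.
  have hsmall : Tendsto (fun t : ℝ => ‖H (x₀ + t • d)‖ / t) (𝓝[>] 0) (𝓝 0) := by
    have hderiv : HasDerivAt (fun t : ℝ => H (x₀ + t • d)) (A d) 0 := by
      have h1 : HasDerivAt (fun t : ℝ => x₀ + t • d) d 0 := by
        simpa using ((hasDerivAt_id (0 : ℝ)).smul_const d).const_add x₀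
      exact HasFDerivAt.comp_hasDerivAt (0 : ℝ) (by simpa using hH) h1
    have := (hderiv.tendsto_slope_zero_right).norm
    rw [hd, norm_zero] at this
    refine this.congr' ?_
    filter_upwards [self_mem_nhdsWithin] with t ht
    have ht : 0 < t := ht
    simp [hx₀, norm_smul, abs_of_pos ht, div_eq_inv_mul]
  have hexists : ∀ᶠ t in 𝓝[>] (0 : ℝ), ∃ v : E, ‖v‖ ≤ K * ‖H (x₀ + t • d)‖ ∧
      H (x₀ + t • d + v) = 0 := by
    have hHp : Tendsto (fun t : ℝ => ‖x₀ + t • d - x₀‖ + K * ‖H (x₀ + t • d)‖) (𝓝[>] 0)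
        (𝓝 (‖x₀ - x₀‖ + K * ‖H x₀‖)) :=
      (hline.sub_const x₀).norm.add ((hH.continuousAt.tendsto.comp hline).norm.const_mul K)
    simp only [sub_self, norm_zero, hx₀, mul_zero, add_zero] at hHp
    filter_upwards [hHp.eventually (gt_mem_nhds hR)] with t ht
    obtain ⟨q, hq1, hq2⟩ := hcorr (x₀ + t • d) fun w hw => by
      rw [mem_closedBall_iff_norm] at hw ⊢
      have := norm_add_le (w - (x₀ + t • d)) (x₀ + t • d - x₀)
      rw [sub_add_sub_cancel] at this
      linarith
    exact ⟨q - (x₀ + t • d), hq1, by rwa [add_sub_cancel]⟩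
  obtain ⟨r, hr⟩ := hexists.choice
  refine ⟨r, ?_, hr.mono fun t ht => ht.2⟩
  have hK : Tendsto (fun t : ℝ => K * (‖H (x₀ + t • d)‖ / t)) (𝓝[>] 0) (𝓝 0) := by
    simpa using hsmall.const_mul K
  refine squeeze_zero' ?_ ?_ hK
  · filter_upwards [self_mem_nhdsWithin] with t ht
    have ht : 0 < t := ht
    positivity
  · filter_upwards [self_mem_nhdsWithin, hr] with t ht h
    have ht : 0 < t := ht
    rw [← mul_div_assoc]
    exact div_le_div_of_nonneg_right h.1 ht.le

/-- A function whose derivative is in the closed span of the derivatives of functions that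
are constant on a set is infinitesimally constant along this set. -/
theorem eventually_abs_sub_le_of_mem_closedSpan {f : ℕ → E → ℝ} {f' : ℕ → StrongDual ℝ E}
    {J : Set ℕ} {x : E} (hf : ∀ i ∈ J, HasFDerivAt (f i) (f' i) x) {g : E → ℝ}
    {g' : StrongDual ℝ E} (hg : HasFDerivAt g g' x) (hmem : g' ∈ closedSpan f' J)
    {κ : ℝ} (hκ : 0 < κ) :
    ∀ᶠ q in 𝓝 x, (∀ i ∈ J, f i q = f i x) → |g q - g x| ≤ κ * ‖q - x‖ := by
  obtain ⟨h', hh', hdist⟩ := Metric.mem_closure_iff.1 hmem (κ / 2) (by positivity)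
  -- A finite combination `h'` close to `g'` is the derivative of the same combination `h` of the `f
  -- i`; only `g - h`, with derivative of norm at most `κ / 2`, can vary along the set.
  have hspan : ∃ h : E → ℝ, HasFDerivAt h h' x ∧ ∀ q, (∀ i ∈ J, f i q = f i x) → h q = h x := by
    refine Submodule.span_induction (p := fun h' _ => ∃ h : E → ℝ, HasFDerivAt h h' x ∧
      ∀ q, (∀ i ∈ J, f i q = f i x) → h q = h x) ?_ ?_ ?_ ?_ hh'
    · rintro _ ⟨i, hi, rfl⟩
      exact ⟨f i, hf i hi, fun q hq => hq i hi⟩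
    · exact ⟨0, hasFDerivAt_zero x, fun _ _ => rfl⟩
    · rintro u v - - ⟨h₁, h₁', e₁⟩ ⟨h₂, h₂', e₂⟩
      exact ⟨h₁ + h₂, h₁'.add h₂', fun q hq => by simp [e₁ q hq, e₂ q hq]⟩
    · rintro a u - ⟨h₁, h₁', e₁⟩
      exact ⟨a • h₁, h₁'.const_smul a, fun q hq => by simp [e₁ q hq]⟩
  obtain ⟨h, hh, hconst⟩ := hspan
  have hdiff := (hg.sub hh).isLittleO.def (show 0 < κ / 2 by positivity)
  filter_upwards [hdiff] with q hq hqJ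
  simp only [Pi.sub_apply, hconst q hqJ] at hq
  rw [sub_sub_sub_cancel_right] at hq
  have h1 : ‖(g' - h') (q - x)‖ ≤ κ / 2 * ‖q - x‖ :=
    ((g' - h').le_opNorm _).trans (by
      gcongr; rw [← dist_eq_norm]; exact hdist.le)
  have h2 := norm_add_le (g q - g x - (g' - h') (q - x)) ((g' - h') (q - x))
  rw [sub_add_cancel, Real.norm_eq_abs] at h2
  linarith

end Fibres

/-! ### Sums in increasing order -/

section OrderedSums

instance orderedSum_neBot (J : Set ℕ) : (orderedSum J).NeBot :=
  ⟨by unfold orderedSum; infer_instance⟩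

theorem hasSum_orderedSum_iff {X : Type*} [AddCommMonoid X] [TopologicalSpace X] {J : Set ℕ}
    {f : J → X} {a : X} : HasSum f a (orderedSum J) ↔
      Tendsto (fun n => ∑ i ∈ initialSegment J n, f i) atTop (𝓝 a) := by
  rw [HasSum, orderedSum, tendsto_map'_iff]; rfl

open Classical in
theorem sum_initialSegment {X : Type*} [AddCommMonoid X] (J : Set ℕ) (f : ℕ → X) (n : ℕ) :
    ∑ i ∈ initialSegment J n, f i = ∑ i ∈ Finset.range n, J.indicator f i := by
  rw [initialSegment, Finset.sum_subtype_eq_sum_filter, Finset.sum_filter]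
  rfl

theorem le_closedSpan_of_basis {X : Type*} [NormedAddCommGroup X] [NormedSpace ℝ X]
    {W : Submodule ℝ X} {v : ℕ → X} {J : Set ℕ}
    (c : GeneralSchauderBasis J ℝ W (orderedSum J)) (hc : ∀ i : J, (c i : X) = v i) :
    W ≤ closedSpan v J := by
  intro w hw
  have h := hasSum_orderedSum_iff.1 (c.expansion ⟨w, hw⟩)
  have h' := (continuous_subtype_val.tendsto _).comp h
  refine mem_closure_of_tendsto h' (Eventually.of_forall fun n => ?_)
  simp only [Function.comp_apply, Submodule.coe_sum, Submodule.coe_smul, hc]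
  exact Submodule.sum_mem _ fun i _ => Submodule.smul_mem _ _
    (Submodule.subset_span ⟨i, i.2, rfl⟩)

end OrderedSums

/-! ### Coefficient maps between `F` and `ℓ²` -/

section Coefficients

variable {F : Type*} [NormedAddCommGroup F] [NormedSpace ℝ F]

theorem IsBesselian.memℓp_coord {b : SchauderBasis ℝ F} (hb : IsBesselian b) (J : Set ℕ) (y : F) :
    Memℓp (fun i : J => b.coord i y) 2 := by
  refine memℓp_gen ?_
  have := (hb _ (b.expansion y).summable).subtype J
  simpa [Function.comp_def] using! this

/-- The coefficient map of a Besselian basis, with values in `ℓ²`. -/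
theorem IsBesselian.exists_coordMap [CompleteSpace F] {b : SchauderBasis ℝ F}
    (hb : IsBesselian b) (J : Set ℕ) :
    ∃ T : F →L[ℝ] lp (fun _ : J => ℝ) 2, ∀ y i, T y i = b.coord i y := by
  let T : F →ₗ[ℝ] lp (fun _ : J => ℝ) 2 :=
    { toFun := fun y => ⟨fun i => b.coord i y, hb.memℓp_coord J y⟩
      map_add' := fun x y => by ext i; exact map_add _ _ _
      map_smul' := fun a x => by ext i; exact map_smul _ _ _ }
  -- Closed graph theorem: coordinates are continuous on both sides.
  refine ⟨ContinuousLinearMap.ofSeqClosedGraph (g := T) fun u x y hux huy => ?_, fun y i => rfl⟩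
  ext i
  have h1 : Tendsto (fun n => T (u n) i) atTop (𝓝 (y i)) :=
    ((lp.evalCLM ℝ (fun _ : J => ℝ) 2 i).continuous.tendsto y).comp huy
  exact tendsto_nhds_unique h1 (((b.coord i).continuous.tendsto x).comp hux)

theorem IsHilbertian.summable_orderedSum {b : SchauderBasis ℝ F} (hb : IsHilbertian b)
    {J : Set ℕ} {a : J → ℝ} (ha : Summable fun i => a i ^ 2) :
    Summable (fun i : J => a i • b i) (orderedSum J) := by
  classical
  let α : ℕ → ℝ := fun i => if h : i ∈ J then a ⟨i, h⟩ else 0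
  have hα : Summable fun i => α i ^ 2 := by
    have : (fun i => α i ^ 2) = Function.extend ((↑) : J → ℕ) (fun i => a i ^ 2) 0 := by
      ext i
      by_cases h : i ∈ J
      · rw [show i = ((⟨i, h⟩ : J) : ℕ) from rfl, Subtype.val_injective.extend_apply]
        simp [α, h]
      · rw [Function.extend_apply' _ _ _ (by rintro ⟨j, rfl⟩; exact h j.2)]
        simp [α, h]
    rw [this, summable_extend_zero Subtype.val_injective]
    exact ha
  obtain ⟨y, hy⟩ := hb α hα
  refine ⟨y, hasSum_orderedSum_iff.2 ?_⟩
  rw [HasSum, SummationFilter.conditional_filter_eq_map_range, tendsto_map'_iff] at hy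
  refine hy.congr fun n => ?_
  have h1 : ∀ i : J, a i • b i = (fun i => α i • b i) i := fun i => by simp [α]
  rw [Finset.sum_congr rfl fun i _ => h1 i, sum_initialSegment J fun i => α i • b i]
  refine Finset.sum_congr rfl fun i _ => ?_
  by_cases h : i ∈ J <;> simp [α, h]

/-- For a Hilbertian basis the `ℓ²`-norm dominates the norm of `Y(J)`. -/
theorem IsHilbertian.exists_norm_sum_le {b : SchauderBasis ℝ F}
    (hb : IsHilbertian b) (J : Set ℕ) :
    ∃ C : ℝ, 0 < C ∧ ∀ (a : lp (fun _ : J => ℝ) 2) (n : ℕ),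
      ‖∑ i ∈ initialSegment J n, a i • b i‖ ≤ C * ‖a‖ := by
  let S : ℕ → lp (fun _ : J => ℝ) 2 →L[ℝ] F := fun n =>
    ∑ i ∈ initialSegment J n, (lp.evalCLM ℝ (fun _ : J => ℝ) 2 i).smulRight (b i)
  have hS : ∀ n a, S n a = ∑ i ∈ initialSegment J n, a i • b i := fun n a => by
    simp only [S, sum_apply]; rfl
  -- The partial sum operators are pointwise bounded, because each series converges.
  obtain ⟨C, hC⟩ := banach_steinhaus (g := S) fun a => by
    have ha : Summable fun i => a i ^ 2 := by
      have := (lp.memℓp a).summable (by norm_num)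
      simpa using this
    obtain ⟨y, hy⟩ := hb.summable_orderedSum ha
    obtain ⟨B, hB⟩ := (hasSum_orderedSum_iff.1 hy).norm.bddAbove_range
    exact ⟨B, fun n => by rw [hS]; exact hB ⟨n, rfl⟩⟩
  refine ⟨max C 1, by positivity, fun a n => ?_⟩
  rw [← hS]
  exact (S n).le_of_opNorm_le ((hC n).trans (le_max_left _ _)) a

/-- A linear map into `ℓ²(J)` whose range contains all unit vectors and is closed in `Y(J)`
is onto. -/
theorem surjective_of_isClosedInSeqSpace {E : Type*} [NormedAddCommGroup E] [NormedSpace ℝ E]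
    {b : SchauderBasis ℝ F} (hb : IsHilbertian b) {J : Set ℕ}
    (A : E →L[ℝ] lp (fun _ : J => ℝ) 2)
    (hclosed : IsClosedInSeqSpace b J (Set.range fun (e : E) (i : J) => A e i))
    (hsingle : ∀ i, ∃ e, A e = lp.single 2 i (1 : ℝ)) : Function.Surjective A := by
  classical
  obtain ⟨C, hC, hbound⟩ := hb.exists_norm_sum_le J
  have hseq : ∀ a : lp (fun _ : J => ℝ) 2, (fun i => a i) ∈ seqSpace b J := fun a =>
    hb.summable_orderedSum (by
      have := (lp.memℓp a).summable (by norm_num)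
      simpa using this)
  intro a
  -- Truncations of `a` lie in the range, being finite combinations of unit vectors. They converge
  -- to `a` in `ℓ²`, hence in `Y(J)`.
  obtain ⟨e, he⟩ := hclosed (fun i => a i) (hseq a) fun ε hε => by
    obtain ⟨δ, hδ, hδε⟩ : ∃ δ : ℝ, 0 < δ ∧ ENNReal.ofReal (C * δ) < ε := by
      obtain ⟨η, hη, hηε⟩ := ENNReal.lt_iff_exists_nnreal_btwn.1 hε
      refine ⟨η / C, div_pos (by exact_mod_cast hη) hC, ?_⟩
      rwa [mul_div_cancel₀ _ hC.ne', ENNReal.ofReal_coe_nnreal]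
    have hsum := lp.hasSum_single (p := 2) (by norm_num) a
    obtain ⟨s, hs⟩ := (Metric.tendsto_nhds.1 hsum δ hδ).exists
    obtain ⟨e, he⟩ : ∃ e, A e = ∑ i ∈ s, lp.single 2 i (a i) := by
      choose u hu using hsingle
      refine ⟨∑ i ∈ s, a i • u i, ?_⟩
      rw [map_sum]
      refine Finset.sum_congr rfl fun i _ => ?_
      rw [map_smul, hu, ← lp.single_smul, smul_eq_mul, mul_one]
    refine ⟨fun i => A e i, ⟨⟨e, rfl⟩, hseq _⟩, lt_of_le_of_lt (iSup_le fun n => ?_) hδε⟩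
    rw [← ofReal_norm]
    refine ENNReal.ofReal_le_ofReal ?_
    have := hbound (A e - a) n
    refine this.trans ?_
    gcongr
    rw [he, ← dist_eq_norm]
    exact hs.le
  exact ⟨e, by ext i; exact congrFun he i⟩

end Coefficients

/-! ### Tangent cones and the constant rank condition -/

section Problem

variable {E F : Type*} [NormedAddCommGroup E] [NormedSpace ℝ E]
  [NormedAddCommGroup F] [NormedSpace ℝ F]

theorem hasFDerivAt_constraint {b : SchauderBasis ℝ F} {G : E → F} (hG : ContDiff ℝ 1 G)
    (i : ℕ) (x : E) : HasFDerivAt (constraint b G i) (dconstraint b G x i) x :=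
  (((b.coord i).differentiable.comp (hG.differentiable one_ne_zero)) x).hasFDerivAt

theorem dconstraint_apply {b : SchauderBasis ℝ F} {G : E → F} (hG : ContDiff ℝ 1 G)
    (i : ℕ) (x d : E) : dconstraint b G x i d = b.coord i (fderiv ℝ G x d) := by
  have h : HasFDerivAt (constraint b G i) ((b.coord i).comp (fderiv ℝ G x)) x :=
    (b.coord i).hasFDerivAt.comp x (hG.differentiable one_ne_zero x).hasFDerivAt
  rw [(hasFDerivAt_constraint hG i x).unique h]; rfl

/-- The tangent cone of a set is mapped by the derivative into the tangent cone of a set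
containing its image. -/
theorem fderiv_mem_tangentCone {G : E → F} {G' : E →L[ℝ] F} {x d : E} (hG : HasFDerivAt G G' x)
    {Q : Set E} {P : Set F} (hQ : Set.MapsTo G Q P) (hd : d ∈ tangentCone Q x) :
    G' d ∈ tangentCone P (G x) := by
  obtain ⟨u, t, hu, ht, hux, ht0, hlim⟩ := hd
  refine ⟨fun k => G (u k), t, fun k => hQ (hu k), ht, hG.continuousAt.tendsto.comp hux, ht0, ?_⟩
  have h := (hasFDerivWithinAt_univ.2 hG).lim (by simpa using hux.sub_const x)
    (Eventually.of_forall fun _ => Set.mem_univ _) hlim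
  simpa using h

theorem coord_eq_zero_of_mem_tangentCone {b : SchauderBasis ℝ F} {I₀ I₁ : Set ℕ} {y d : F}
    (hy : y ∈ basisCone b I₀ I₁) (hd : d ∈ tangentCone (basisCone b I₀ I₁) y) {i : ℕ}
    (hi : i ∈ I₀) : b.coord i d = 0 := by
  obtain ⟨u, t, hu, -, -, -, hlim⟩ := hd
  refine tendsto_nhds_unique (((b.coord i).continuous.tendsto d).comp hlim) ?_
  refine tendsto_const_nhds.congr fun k => ?_
  simp [(hu k).2.1 i hi, hy.2.1 i hi]

/-- A feasible curve tangent to `d` exhibits `d` as a tangent direction. -/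
theorem mem_tangentCone_of_curve {Q : Set E} {x d : E} {r : ℝ → E} (hr : IsSmallCurve r)
    (hQ : ∀ᶠ t in 𝓝[>] (0 : ℝ), x + t • d + r t ∈ Q) : d ∈ tangentCone Q x := by
  obtain ⟨ε, hε, hQε⟩ := mem_nhdsGT_iff_exists_Ioo_subset.1 hQ
  have hε : 0 < ε := hε
  let t : ℕ → ℝ := fun k => ε / 2 * (1 / ((k : ℝ) + 1))
  have ht : ∀ k, 0 < t k := fun k => by positivity
  have ht0 : Tendsto t atTop (𝓝 0) := by
    have := (tendsto_one_div_add_atTop_nhds_zero_nat (𝕜 := ℝ)).const_mul (ε / 2)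
    rwa [mul_zero] at this
  have htε : ∀ k, t k < ε := fun k => by
    have : 1 / ((k : ℝ) + 1) ≤ 1 := by
      rw [div_le_one (by positivity)]; linarith [k.cast_nonneg (α := ℝ)]
    have : t k ≤ ε / 2 * 1 := mul_le_mul_of_nonneg_left this (by positivity)
    linarith
  have htw : Tendsto t atTop (𝓝[>] 0) :=
    tendsto_nhdsWithin_iff.2 ⟨ht0, Eventually.of_forall ht⟩
  have hlim : Tendsto (fun k => d + (t k)⁻¹ • r (t k)) atTop (𝓝 (d + 0)) := by
    refine tendsto_const_nhds.add (tendsto_zero_iff_norm_tendsto_zero.2 ?_)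
    refine (hr.comp htw).congr fun k => ?_
    simp [norm_smul, abs_of_pos (ht k), div_eq_inv_mul]
  rw [add_zero] at hlim
  have hscale : ∀ k, t k • (d + (t k)⁻¹ • r (t k)) = t k • d + r (t k) := fun k => by
    rw [smul_add, smul_inv_smul₀ (ht k).ne']
  refine ⟨fun k => x + t k • d + r (t k), t, fun k => hQε ⟨ht k, htε k⟩, ht, ?_, ht0, ?_⟩
  · have := (ht0.smul hlim).const_add x
    rw [zero_smul, add_zero] at this
    exact this.congr fun k => by rw [hscale, add_assoc]
  · refine hlim.congr fun k => ?_
    simp only [add_assoc, add_sub_cancel_left]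
    rw [← hscale, inv_smul_smul₀ (ht k).ne']

/-- Under the Constant Rank Condition Plus, a direction annihilated by all `Dgᵢ(x₀)`, `i ∈ J`, is
tangent to a curve along which all `gᵢ`, `i ∈ J`, vanish. -/
theorem CRCPlus.exists_curve [CompleteSpace E] [CompleteSpace F] {b : SchauderBasis ℝ F}
    (hBessel : IsBesselian b) (hHilbert : IsHilbertian b) {G : E → F} (hG : ContDiff ℝ 1 G)
    {J : Set ℕ} {x₀ : E} {V : Set E} (hV : V ∈ 𝓝 x₀) (hJ : CRCPlus b G J x₀ V)
    (hx₀ : ∀ i ∈ J, constraint b G i x₀ = 0) {d : E} (hd : ∀ i ∈ J, dconstraint b G x₀ i d = 0) :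
    ∃ r : ℝ → E, IsSmallCurve r ∧
      ∀ᶠ t in 𝓝[>] (0 : ℝ), ∀ i ∈ J, constraint b G i (x₀ + t • d + r t) = 0 := by
  obtain ⟨J₂, hJ₂, hbasis, -, hclosed, c, hc, -, -, -, hrep⟩ := hJ
  obtain ⟨T, hT⟩ := hBessel.exists_coordMap J₂
  have hstrict : HasStrictFDerivAt (fun x => T (G x)) (T.comp (fderiv ℝ G x₀)) x₀ :=
    T.hasStrictFDerivAt.comp x₀ (hG.contDiffAt.hasStrictFDerivAt one_ne_zero)
  have hAapp : ∀ (e : E) (i : J₂), T.comp (fderiv ℝ G x₀) e i = dconstraint b G x₀ i e :=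
    fun e i => by rw [dconstraint_apply hG]; exact hT _ _
  have hH0 : ∀ x, T (G x) = 0 ↔ ∀ i ∈ J₂, constraint b G i x = 0 := fun x => by
    refine ⟨fun h i hi => ?_, fun h => ?_⟩
    · have := hT (G x) ⟨i, hi⟩
      rw [h] at this
      exact this.symm
    · ext i
      rw [hT]
      exact h i i.2
  have hsurj : Function.Surjective (T.comp (fderiv ℝ G x₀)) := by
    classical
    refine surjective_of_isClosedInSeqSpace hHilbert _ ?_ fun i => ?_
    · simpa only [hAapp] using hclosed
    · obtain ⟨e, he⟩ := hrep i
      refine ⟨e, ?_⟩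
      ext j
      -- Biorthogonality: `Dgⱼ(x₀) eᵢ` is the `i`-th coordinate of the `j`-th basis vector.
      rw [hAapp, ← hc, ← he, c.ortho, lp.single_apply]
      by_cases h : i = j
      · subst h; simp
      · simp [h, Ne.symm h]
  obtain ⟨K, R, k, hK, hR, hkK, hRV, happrox, hcorr⟩ :=
    exists_approximatesLinearOn_and_correction hstrict hsurj hV
  have hx₀H : T (G x₀) = 0 := (hH0 x₀).2 fun i hi => hx₀ i (hJ₂ hi)
  obtain ⟨r, hr, hrH⟩ := exists_isSmallCurve_fibre (d := d) hR hstrict.hasFDerivAt hcorr hx₀H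
    (by ext i; rw [hAapp, hd i (hJ₂ i.2)]; rfl)
  have hlim : Tendsto (fun t : ℝ => ‖t • d + r t‖) (𝓝[>] 0) (𝓝 0) := by
    have h1 : Tendsto (fun t : ℝ => t) (𝓝[>] 0) (𝓝 0) := nhdsWithin_le_nhds
    have h2 : Tendsto (fun t : ℝ => |t| * ‖d‖ + t * (‖r t‖ / t)) (𝓝[>] 0) (𝓝 0) := by
      simpa using (h1.abs.mul_const ‖d‖).add (h1.mul hr)
    refine squeeze_zero' (Eventually.of_forall fun t => norm_nonneg _) ?_ h2
    filter_upwards [self_mem_nhdsWithin] with t ht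
    rw [mul_div_cancel₀ _ (ne_of_gt ht)]
    exact (norm_add_le _ _).trans (by rw [norm_smul, Real.norm_eq_abs])
  refine ⟨r, hr, ?_⟩
  filter_upwards [hrH, hlim.eventually (gt_mem_nhds (show 0 < R / 8 by positivity))]
    with t ht htR i hi
  rw [← hx₀ i hi]
  have hTG : Continuous fun x => T (G x) := T.continuous.comp hG.continuous
  refine eq_of_infinitesimally_constant hK hkK happrox hcorr hTG
    ((b.coord i).continuous.comp hG.continuous) (fun x hx κ hκ => ?_) hx₀H ht ?_
  -- The basis property is needed here at every `x` of the ball, not only at `x₀`.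
  · obtain ⟨c', hc'⟩ := hbasis x (hRV hx)
    have hmem : dconstraint b G x i ∈ closedSpan (dconstraint b G x) J₂ :=
      le_closedSpan_of_basis c' hc'
        (subset_closure (Submodule.subset_span ⟨i, hi, rfl⟩))
    filter_upwards [eventually_abs_sub_le_of_mem_closedSpan
      (fun j _ => hasFDerivAt_constraint hG j x) (hasFDerivAt_constraint hG i x) hmem hκ]
      with q hq hxq hqH
    exact hq fun j hj => by rw [(hH0 x).1 hxq j hj, (hH0 q).1 hqH j hj]
  · rw [add_assoc, add_sub_cancel_left]
    linarith

end Problem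

end AbadieRCRCQ

theorem mainTheorem1 {E F : Type*}
    [NormedAddCommGroup E] [NormedSpace ℝ E] [CompleteSpace E]
    [NormedAddCommGroup F] [InnerProductSpace ℝ F] [CompleteSpace F]
    (b : SchauderBasis ℝ F)
    (hBessel : AbadieRCRCQ.IsBesselian b) (hHilbert : AbadieRCRCQ.IsHilbertian b)
    (I₀ I₁ : Set ℕ) (hI : Disjoint I₀ I₁)
    (G : E → F) (hG : ContDiff ℝ 1 G)
    (hGexp : ∀ x, HasSum (fun i : ↥(I₀ ∪ I₁) => AbadieRCRCQ.constraint b G i x • b i) (G x)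
      (AbadieRCRCQ.orderedSum (I₀ ∪ I₁)))
    (x₀ : E) (hx₀ : x₀ ∈ AbadieRCRCQ.feasibleSet b G I₀ I₁)
    (hRCRCQ : AbadieRCRCQ.RCRCQPlus b G I₀ I₁ x₀)
    (hH1 : AbadieRCRCQ.ConditionH1 b G I₀ I₁ x₀) :
    AbadieRCRCQ.linearizedCone b G I₀ I₁ x₀ =
        AbadieRCRCQ.tangentCone (AbadieRCRCQ.feasibleSet b G I₀ I₁) x₀ ∧
      ∀ d ∈ AbadieRCRCQ.tangentCone (AbadieRCRCQ.feasibleSet b G I₀ I₁) x₀,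
        ∃ r : ℝ → E, AbadieRCRCQ.IsSmallCurve r ∧
          ∃ ε > 0, ∀ t ∈ Set.Ioo (0 : ℝ) ε,
            (∀ i ∈ I₀ ∪ AbadieRCRCQ.activeSetDir b G I₁ x₀ d,
              AbadieRCRCQ.constraint b G i (x₀ + t • d + r t) = 0) ∧
            (∀ l ∈ I₁ \ (I₀ ∪ AbadieRCRCQ.activeSetDir b G I₁ x₀ d),
              AbadieRCRCQ.constraint b G l (x₀ + t • d + r t) ≤ 0) := by
  have hmaps : Set.MapsTo G (AbadieRCRCQ.feasibleSet b G I₀ I₁)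
      (AbadieRCRCQ.basisCone b I₀ I₁) := fun x hx => ⟨hGexp x, hx.1, hx.2⟩
  have hsub : AbadieRCRCQ.tangentCone (AbadieRCRCQ.feasibleSet b G I₀ I₁) x₀ ⊆
      AbadieRCRCQ.linearizedCone b G I₀ I₁ x₀ := fun d hd =>
    AbadieRCRCQ.fderiv_mem_tangentCone (hG.differentiable one_ne_zero x₀).hasFDerivAt hmaps hd
  have hcurve : ∀ d ∈ AbadieRCRCQ.linearizedCone b G I₀ I₁ x₀,
      ∃ r : ℝ → E, AbadieRCRCQ.IsSmallCurve r ∧ ∃ ε > 0, ∀ t ∈ Set.Ioo (0 : ℝ) ε,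
        (∀ i ∈ I₀ ∪ AbadieRCRCQ.activeSetDir b G I₁ x₀ d,
          AbadieRCRCQ.constraint b G i (x₀ + t • d + r t) = 0) ∧
        (∀ l ∈ I₁ \ (I₀ ∪ AbadieRCRCQ.activeSetDir b G I₁ x₀ d),
          AbadieRCRCQ.constraint b G l (x₀ + t • d + r t) ≤ 0) := by
    intro d hd
    obtain ⟨V, hV, hcrc⟩ := hRCRCQ
    -- The index set depends on `d`, which is why the rank condition is required for all `J` between
    -- `I₀` and `I₀ ∪ I(x₀)`.
    obtain ⟨r, hr, hrt⟩ := (hcrc (I₀ ∪ AbadieRCRCQ.activeSetDir b G I₁ x₀ d)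
      Set.subset_union_left (Set.union_subset_union_right _ fun i hi => hi.1)).exists_curve
      hBessel hHilbert hG hV
      (by rintro i (hi | hi)
          exacts [hx₀.1 i hi, hi.1.2])
      (d := d)
      (by rintro i (hi | hi)
          · rw [AbadieRCRCQ.dconstraint_apply hG]
            exact AbadieRCRCQ.coord_eq_zero_of_mem_tangentCone (hmaps hx₀) hd hi
          · exact hi.2)
    obtain ⟨ε₁, hε₁, h1⟩ := mem_nhdsGT_iff_exists_Ioo_subset.1 hrt
    obtain ⟨ε₂, hε₂, h2⟩ := hH1 d hd r hr
    refine ⟨r, hr, min ε₁ ε₂, lt_min hε₁ hε₂, fun t ht => ⟨?_, fun l hl => ?_⟩⟩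
    · exact h1 ⟨ht.1, ht.2.trans_le (min_le_left _ _)⟩
    · exact h2 l ⟨hl.1, fun h => hl.2 (Or.inr h)⟩ t ⟨ht.1, ht.2.trans_le (min_le_right _ _)⟩
  refine ⟨Set.Subset.antisymm (fun d hd => ?_) hsub, fun d hd => hcurve d (hsub hd)⟩
  obtain ⟨r, hr, ε, hε, h⟩ := hcurve d hd
  refine AbadieRCRCQ.mem_tangentCone_of_curve hr ?_
  filter_upwards [Ioo_mem_nhdsGT hε] with t ht
  obtain ⟨heq, hle⟩ := h t ht
  refine ⟨fun i hi => heq i (Or.inl hi), fun i hi => ?_⟩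
  by_cases hmem : i ∈ I₀ ∪ AbadieRCRCQ.activeSetDir b G I₁ x₀ d
  · exact (heq i hmem).le
  · exact hle i ⟨hi, hmem⟩
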